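/- Let $G=(V,E)$ be a finite simple graph. A (coalition) game $\mathcal{G}$ on $G$ is a valuation $v:2^V\to\mathbb{N}$ with $v(S)=0$ for every $S\subseteq V$ that does not induce a connected (nonempty) subgraph of $G$. Let $$\kappa(\mathcal{G})=\min\Big\{\sum_{i\in V}x_i \;:\; x\in\mathbb{Z}_{\ge 0}^{V},\ \sum_{i\in S}x_i\ge v(S)\ \ \forall S\subseteq V\Big\}$$ and $$\rho(\mathcal{G})=\max\Big\{\sum_{S\subseteq V}v(S)\,y_S \;:\; y\in\mathbb{Z}_{\ge 0}^{2^V},\ \sum_{S\ni i}y_S\le 1\ \ \forall i\in V\Big\}$$ be the optimal values of the integral covering and packing programs. The packing-covering ratio of $\mathcal{G}$ is $\kappa(\mathcal{G})/\rho(\mathcal{G})$, read as $0$ if $\kappa(\mathcal{G})=\rho(\mathcal{G})=0$ and as $\infty$ if only $\rho(\mathcal{G})=0$. The VC-dimension of a family $\mathcal{S}$ of subsets of $V$ is the maximum size of a set $X\subseteq V$ such that every $Y\subseteq X$ equals $X\cap S$ for some $S\in\mathcal{S}$ (and $0$ if there is no such $X$). The VC-dimension of $G$ is that of the family of all vertex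 sets inducing a connected subgraph of $G$. If $G$ has VC-dimension $d$, then every game $\mathcal{G}$ on $G$ (simple or not) satisfies $$\frac{\kappa(\mathcal{G})}{\rho(\mathcal{G})}\le d .$$ This holds for every $G$ if the empty set is counted as connected in the definition of the VC-dimension of $G$; and if the empty set is not counted as connected, it holds for every $G$ with $|V|\ne 1$. -/

import Mathlib

/-- A coalition game over the interaction graph `G`: a valuation `v : 2^V → ℕ` on coalitions of
agents that vanishes on every coalition that is not viable, i.e. does not induce a connected
subgraph (in Mathlib a connected graph is nonempty, so in particular `v ∅ = 0`). -/
structure GraphicalGame {V : Type*} (G : SimpleGraph V) where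
  /-- The wealth that a coalition can generate by itself. -/
  value : Finset V → ℕ
  /-- Non-viable coalitions generate nothing. -/
  value_eq_zero : ∀ S : Finset V, ¬ (G.induce (S : Set V)).Connected → value S = 0

namespace GraphicalGame

theorem value_empty {V : Type*} {G : SimpleGraph V} (Γ : GraphicalGame G) : Γ.value ∅ = 0 := by
  apply Γ.value_eq_zero
  intro h
  obtain ⟨⟨x, hx⟩⟩ := h.nonempty
  simp at hx

variable {V : Type*} [Fintype V] [DecidableEq V] {G : SimpleGraph V}

/-- Integral feasible solutions of the covering LP: payoffs `x i` with `∑ i ∈ S, x i ≥ v S`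
for every coalition `S`. -/
def IsCover (Γ : GraphicalGame G) (x : V → ℕ) : Prop :=
  ∀ S : Finset V, Γ.value S ≤ ∑ i ∈ S, x i

/-- Integral feasible solutions of the packing LP: every agent lies in at most one of the
chosen coalitions (counted with multiplicity `y S`). -/
def IsPacking (y : Finset V → ℕ) : Prop :=
  ∀ i : V, ∑ S : Finset V with i ∈ S, y S ≤ 1

/-- The value of an integral packing. -/
def packingValue (Γ : GraphicalGame G) (y : Finset V → ℕ) : ℕ :=
  ∑ S : Finset V, Γ.value S * y S

/-- The optimal value `κ` of the integral covering program. -/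
noncomputable def coveringNumber (Γ : GraphicalGame G) : ℕ :=
  sInf {k | ∃ x : V → ℕ, Γ.IsCover x ∧ ∑ i, x i = k}

/-- The optimal value `ρ` of the integral packing program. -/
noncomputable def packingNumber (Γ : GraphicalGame G) : ℕ :=
  sSup {k | ∃ y : Finset V → ℕ, IsPacking y ∧ Γ.packingValue y = k}

/-- The packing-covering ratio `κ / ρ`, as an extended nonnegative real: `a / 0 = ∞` for `a ≠ 0`,
and `0 / 0 = 0` for the trivial game `v = 0`. -/
noncomputable def packingCoveringRatio (Γ : GraphicalGame G) : ENNReal :=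
  (Γ.coveringNumber : ENNReal) / (Γ.packingNumber : ENNReal)

/-- The covering number is attained. -/
theorem isLeast_coveringNumber (Γ : GraphicalGame G) :
    IsLeast {k | ∃ x : V → ℕ, Γ.IsCover x ∧ ∑ i, x i = k} Γ.coveringNumber := by
  refine ⟨Nat.sInf_mem ⟨_, fun _ => ∑ T : Finset V, Γ.value T, fun S => ?_, rfl⟩,
    fun k hk => Nat.sInf_le hk⟩
  rcases S.eq_empty_or_nonempty with rfl | ⟨i, hi⟩
  · simp [value_empty]
  · exact (Finset.single_le_sum (f := Γ.value) (fun _ _ => Nat.zero_le _)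
      (Finset.mem_univ S)).trans
        (Finset.single_le_sum (f := fun _ => ∑ T : Finset V, Γ.value T)
          (fun _ _ => Nat.zero_le _) hi)

/-- The packing number is attained. -/
theorem isGreatest_packingNumber (Γ : GraphicalGame G) :
    IsGreatest {k | ∃ y : Finset V → ℕ, IsPacking y ∧ Γ.packingValue y = k}
      Γ.packingNumber := by
  have hb : BddAbove {k | ∃ y : Finset V → ℕ, IsPacking y ∧ Γ.packingValue y = k} := by
    refine ⟨∑ T : Finset V, Γ.value T, ?_⟩
    rintro k ⟨y, hy, rfl⟩
    refine Finset.sum_le_sum fun S _ => ?_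
    rcases S.eq_empty_or_nonempty with rfl | ⟨i, hi⟩
    · simp [value_empty]
    · have h1 : y S ≤ 1 := (Finset.single_le_sum (f := y) (fun _ _ => Nat.zero_le _)
        (Finset.mem_filter.2 ⟨Finset.mem_univ S, hi⟩)).trans (hy i)
      simpa using Nat.mul_le_mul_left (Γ.value S) h1
  exact ⟨Nat.sSup_mem ⟨0, fun _ => 0, fun i => by simp, by simp [packingValue]⟩ hb,
    fun k hk => le_csSup hb hk⟩

end GraphicalGame

open Classical in
/-- The graphical set family of `G`: all (nonempty) vertex sets that induce a connected subgraph. -/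
noncomputable def graphicalSetFamily {V : Type*} [Fintype V] (G : SimpleGraph V) :
    Finset (Finset V) :=
  {S | (G.induce (S : Set V)).Connected}

/-! ### Boundaries of growing vertex sets and shattering -/

section Boundary

open Finset

variable {V : Type*} {G : SimpleGraph V}

/-! Sweep the vertices one at a time, keeping the boundary of the swept set `C` attached to one
connected `A ⊆ C`. Adding any part of the boundary to `A` keeps it connected, so the boundary is
shattered and has at most `d` vertices. A local-ratio argument along the sweep
(`exists_cover_pairwiseDisjoint`) then yields a cover and a disjoint family: each new vertex brings
a set of at most `d` vertices whose payoffs rise by some `r`, while the family gains value at least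
`r`. If the empty set is not connected, `d` can drop only when all of `V` was shattered. Then `V`
has at most `d + 1` vertices, and an explicit cover suffices. -/

theorem connected_induce_singleton (G : SimpleGraph V) (v : V) :
    (G.induce (({v} : Finset V) : Set V)).Connected := by
  rw [coe_singleton, SimpleGraph.induce_singleton_eq_top]
  exact SimpleGraph.connected_top

section

variable [DecidableEq V]

theorem connected_induce_insert {A : Finset V} {a v : V}
    (hA : (G.induce (A : Set V)).Preconnected) (ha : a ∈ A) (hav : G.Adj a v) :
    (G.induce ((insert v A : Finset V) : Set V)).Connected := by
  have h := SimpleGraph.connected_induce_union (t := {v}) hA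
    (by simp) (mem_coe.2 ha) rfl hav
  rwa [Set.union_singleton, ← coe_insert] at h

theorem connected_induce_union_of_adj {A Y : Finset V}
    (hA : (G.induce (A : Set V)).Connected) (hY : ∀ y ∈ Y, ∃ a ∈ A, G.Adj a y) :
    (G.induce ((A ∪ Y : Finset V) : Set V)).Connected := by
  induction Y using Finset.induction_on with
  | empty => rwa [union_empty]
  | insert y Y _ ih =>
    obtain ⟨a, ha, hay⟩ := hY y (mem_insert_self y Y)
    rw [union_insert]
    exact connected_induce_insert (ih fun z hz => hY z (mem_insert_of_mem hz)).preconnected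
      (mem_union_left Y ha) hay

end

variable [Fintype V]

open Classical in
/-- The vertices outside `C` that have a neighbour in `C`. -/
noncomputable def outerBoundary (G : SimpleGraph V) (C : Finset V) : Finset V :=
  {v | v ∉ C ∧ ∃ u ∈ C, G.Adj u v}

theorem mem_outerBoundary {C : Finset V} {v : V} :
    v ∈ outerBoundary G C ↔ v ∉ C ∧ ∃ u ∈ C, G.Adj u v := by
  simp [outerBoundary]

theorem mem_graphicalSetFamily {S : Finset V} :
    S ∈ graphicalSetFamily G ↔ (G.induce (S : Set V)).Connected := by
  simp [graphicalSetFamily]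

/-- A connected set that meets `C` without being contained in it meets the boundary of `C`. -/
theorem exists_mem_outerBoundary {C T : Finset V} (hT : (G.induce (T : Set V)).Connected)
    (hCT : ∃ u ∈ T, u ∈ C) (hTC : ¬ T ⊆ C) : ∃ v ∈ T, v ∈ outerBoundary G C := by
  obtain ⟨u, huT, huC⟩ := hCT
  obtain ⟨w, hwT, hwC⟩ := not_subset.1 hTC
  obtain ⟨p⟩ := hT.preconnected ⟨u, huT⟩ ⟨w, hwT⟩
  obtain ⟨e, -, h1, h2⟩ := p.exists_boundary_dart {z | (z : V) ∈ C} huC hwC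
  exact ⟨e.snd, e.snd.2, mem_outerBoundary.2 ⟨h2, e.fst, h1, e.adj⟩⟩

/-- The boundary of `C` is attached to a single connected subset of `C`. -/
def HasConnectedFront (G : SimpleGraph V) (C : Finset V) : Prop :=
  ∃ A ⊆ C, (G.induce (A : Set V)).Preconnected ∧
    ∀ b ∈ outerBoundary G C, ∃ a ∈ A, G.Adj a b

theorem hasConnectedFront_empty (G : SimpleGraph V) : HasConnectedFront G ∅ := by
  refine ⟨∅, Subset.rfl, fun u => absurd u.2 (by simp), fun b hb => ?_⟩
  obtain ⟨-, u, hu, -⟩ := mem_outerBoundary.1 hb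
  simp at hu

variable [DecidableEq V]

/-- A set of vertices attached to a disjoint connected set is shattered. -/
theorem shatters_of_adj_connected {A B : Finset V} (hA : (G.induce (A : Set V)).Preconnected)
    (hAB : Disjoint A B) (hB : ∀ b ∈ B, ∃ a ∈ A, G.Adj a b) :
    (insert ∅ (graphicalSetFamily G)).Shatters B := by
  intro Y hY
  rcases Y.eq_empty_or_nonempty with rfl | ⟨y, hy⟩
  · exact ⟨∅, mem_insert_self _ _, inter_empty B⟩
  · obtain ⟨a, ha, -⟩ := hB y (hY hy)
    refine ⟨A ∪ Y, mem_insert_of_mem (mem_graphicalSetFamily.2 ?_), ?_⟩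
    · exact connected_induce_union_of_adj ((SimpleGraph.connected_iff _).2 ⟨hA, ⟨⟨a, ha⟩⟩⟩)
        fun z hz => hB z (hY hz)
    · rw [inter_union_distrib_left, disjoint_iff_inter_eq_empty.1 hAB.symm, empty_union,
        inter_eq_right.2 hY]

theorem shatters_singleton (G : SimpleGraph V) (v : V) :
    (insert ∅ (graphicalSetFamily G)).Shatters {v} := by
  refine shatters_of_forall_subset fun Y hY => ?_
  rcases subset_singleton_iff.1 hY with rfl | rfl
  · exact mem_insert_self _ _
  · exact mem_insert_of_mem (mem_graphicalSetFamily.2 (connected_induce_singleton G v))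

theorem HasConnectedFront.card_outerBoundary_le {C : Finset V} (hC : HasConnectedFront G C) :
    #(outerBoundary G C) ≤ (insert ∅ (graphicalSetFamily G)).vcDim := by
  obtain ⟨A, hAC, hA, hB⟩ := hC
  refine (shatters_of_adj_connected hA ?_ hB).card_le_vcDim
  exact disjoint_left.2 fun a ha hb => (mem_outerBoundary.1 hb).1 (hAC ha)

/-- A set with connected front can be enlarged by one vertex `v`, so that few vertices (among
them `v`) meet all connected sets that leave the enlarged set. -/
theorem HasConnectedFront.exists_insert {C : Finset V} (hC : HasConnectedFront G C)
    (hne : C ≠ univ) :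
    ∃ v ∉ C, ∃ B : Finset V, v ∈ B ∧ #B ≤ (insert ∅ (graphicalSetFamily G)).vcDim ∧
      (∀ T : Finset V, (G.induce (T : Set V)).Connected → ¬ T ⊆ insert v C →
        ¬ Disjoint T (insert v C) → ¬ Disjoint T B) ∧ HasConnectedFront G (insert v C) := by
  have hcard := hC.card_outerBoundary_le
  rcases (outerBoundary G C).eq_empty_or_nonempty with h | ⟨v, hv⟩
  · obtain ⟨v, hv⟩ : ∃ v, v ∉ C := by
      by_contra! hall
      exact hne (eq_univ_iff_forall.2 hall)
    refine ⟨v, hv, {v}, mem_singleton_self v, (shatters_singleton G v).card_le_vcDim, ?_, ?_⟩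
    · intro T hT hTC hmeet hdis
      rw [disjoint_singleton_right] at hdis
      obtain ⟨u, huT, hu⟩ := not_disjoint_iff.1 hmeet
      have huC : u ∈ C := (mem_insert.1 hu).resolve_left fun e => hdis (e ▸ huT)
      obtain ⟨z, -, hz⟩ := exists_mem_outerBoundary hT ⟨u, huT, huC⟩
        fun hs => hTC (hs.trans (subset_insert v C))
      simp [h] at hz
    · refine ⟨{v}, by simp, (connected_induce_singleton G v).preconnected, fun b hb => ?_⟩
      obtain ⟨hbC, u, hu, hub⟩ := mem_outerBoundary.1 hb
      rcases mem_insert.1 hu with rfl | hu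
      · exact ⟨u, mem_singleton_self u, hub⟩
      · have : b ∈ outerBoundary G C :=
          mem_outerBoundary.2 ⟨fun hb' => hbC (mem_insert_of_mem hb'), u, hu, hub⟩
        simp [h] at this
  -- The old boundary separates, and the front grows by `v`.
  · refine ⟨v, (mem_outerBoundary.1 hv).1, outerBoundary G C, hv, hcard, ?_, ?_⟩
    · intro T hT hTC hmeet hdis
      obtain ⟨u, huT, hu⟩ := not_disjoint_iff.1 hmeet
      have huC : u ∈ C := (mem_insert.1 hu).resolve_left
        fun e => disjoint_left.1 hdis huT (e ▸ hv)
      obtain ⟨z, hzT, hz⟩ := exists_mem_outerBoundary hT ⟨u, huT, huC⟩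
        fun hs => hTC (hs.trans (subset_insert v C))
      exact disjoint_left.1 hdis hzT hz
    · obtain ⟨A, hAC, hA, hB⟩ := hC
      obtain ⟨a, ha, hav⟩ := hB v hv
      refine ⟨insert v A, insert_subset_insert v hAC,
        (connected_induce_insert hA ha hav).preconnected, fun b hb => ?_⟩
      obtain ⟨hbC, u, hu, hub⟩ := mem_outerBoundary.1 hb
      rcases mem_insert.1 hu with rfl | hu
      · exact ⟨u, mem_insert_self u A, hub⟩
      · obtain ⟨a', ha', h'⟩ := hB b
          (mem_outerBoundary.2 ⟨fun hb' => hbC (mem_insert_of_mem hb'), u, hu, hub⟩)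
        exact ⟨a', mem_insert_of_mem ha', h'⟩

end Boundary

/-! ### Covers and packings by local ratio -/

section Covering

open Finset

variable {V : Type*} [Fintype V] [DecidableEq V] {G : SimpleGraph V}

/-- Weights supported on connected sets that leave `C` have a cover and a disjoint family whose
values differ by a factor of at most `d`. -/
theorem HasConnectedFront.exists_cover_pairwiseDisjoint {d : ℕ}
    (hd : (insert ∅ (graphicalSetFamily G)).vcDim ≤ d) {C : Finset V}
    (hC : HasConnectedFront G C) (w : Finset V → ℕ)
    (hconn : ∀ S, w S ≠ 0 → (G.induce (S : Set V)).Connected) (hzero : ∀ S ⊆ C, w S = 0) :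
    ∃ (x : V → ℕ) (F : Finset (Finset V)), (∀ S, w S ≤ ∑ i ∈ S, x i) ∧
      (F : Set (Finset V)).PairwiseDisjoint id ∧ (∀ T ∈ F, w T ≠ 0) ∧
      ∑ i, x i ≤ d * ∑ T ∈ F, w T := by
  induction hn : #(Cᶜ) generalizing C w with
  | zero =>
    have hCu : C = univ := by simpa using hn
    exact ⟨0, ∅, fun S => by simp [hzero S (hCu ▸ subset_univ S)], by simp, by simp, by simp⟩
  | succ n ih =>
    have hne : C ≠ univ := by rintro rfl; simp at hn
    obtain ⟨v, hv, B, hvB, hBd, hsep, hC'⟩ := hC.exists_insert hne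
    obtain ⟨R, hR, hmax⟩ := exists_max_image (insert v C).powerset w ⟨∅, empty_mem_powerset _⟩
    rw [mem_powerset] at hR
    -- Paying `w R` on each vertex of `B` leaves this residual weight. It vanishes inside `insert v
    -- C`: sets containing `v ∈ B` weigh at most `w R`, the others lie in `C`.
    obtain ⟨x, F, hx, hF, hFw, hsum⟩ := ih hC' (fun S => w S - w R * #(S ∩ B))
      (fun S hS => hconn S fun h => hS (by simp [h]))
      (fun S hS => by
        by_cases hvS : v ∈ S
        · have h1 : 1 ≤ #(S ∩ B) := card_pos.2 ⟨v, mem_inter.2 ⟨hvS, hvB⟩⟩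
          have h2 := hmax S (mem_powerset.2 hS)
          exact Nat.sub_eq_zero_of_le (h2.trans (Nat.le_mul_of_pos_right _ h1))
        · have : w S = 0 := hzero S ((subset_insert_iff_of_notMem hvS).1 hS)
          simp [this])
      (by
        rw [card_compl] at hn ⊢
        rw [card_insert_of_notMem hv]
        omega)
    have hFw' : ∀ T ∈ F, w R * #(T ∩ B) < w T := fun T hT => by
      have := hFw T hT
      omega
    have hcover : ∀ S, w S ≤ ∑ i ∈ S, (x i + if i ∈ B then w R else 0) := fun S => by
      have h1 : ∑ i ∈ S, (if i ∈ B then w R else 0) = w R * #(S ∩ B) := by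
        rw [← sum_filter, sum_const, smul_eq_mul, mul_comm, filter_mem_eq_inter]
      have h2 := hx S
      rw [sum_add_distrib, h1]
      omega
    have htotal : ∑ i, (x i + if i ∈ B then w R else 0) ≤
        d * (∑ T ∈ F, (w T - w R * #(T ∩ B)) + w R) := by
      have h1 : ∑ i, (if i ∈ B then w R else 0) = w R * #B := by
        rw [← sum_filter, sum_const, smul_eq_mul, mul_comm, filter_mem_eq_inter, univ_inter]
      rw [sum_add_distrib, h1, mul_add, mul_comm d (w R)]
      exact add_le_add hsum (Nat.mul_le_mul_left _ (hBd.trans hd))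
    by_cases hhit : w R = 0 ∨ ∃ T ∈ F, ¬ Disjoint T B
    · refine ⟨_, F, hcover, hF, fun T hT => (Nat.zero_le _ |>.trans_lt (hFw' T hT)).ne',
        htotal.trans (Nat.mul_le_mul_left d ?_)⟩
      rcases hhit with h0 | ⟨T, hT, hTB⟩
      · simp [h0]
      -- Restoring the original weights already gains `w R` at `T`.
      · rw [← add_sum_erase F _ hT, ← add_sum_erase F w hT]
        have h1 : 1 ≤ #(T ∩ B) := by
          rw [Nat.one_le_iff_ne_zero, Ne, card_eq_zero, ← disjoint_iff_inter_eq_empty]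
          exact hTB
        have h2 := Nat.le_mul_of_pos_right (w R) h1
        have h3 := hFw' T hT
        have h4 : ∑ S ∈ F.erase T, (w S - w R * #(S ∩ B)) ≤ ∑ S ∈ F.erase T, w S :=
          sum_le_sum fun S _ => Nat.sub_le _ _
        omega
    -- No member of `F` meets `B`, so by separation none meets `R`, and `R` can join `F`.
    · push Not at hhit
      obtain ⟨h0, hdis⟩ := hhit
      have hTR : ∀ T ∈ F, ¬ T ⊆ insert v C ∧ Disjoint R T := fun T hT => by
        have hT0 : w T ≠ 0 := (Nat.zero_le _ |>.trans_lt (hFw' T hT)).ne'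
        have hnot : ¬ T ⊆ insert v C := fun hs => by
          by_cases hvT : v ∈ T
          · exact disjoint_left.1 (hdis T hT) hvT hvB
          · exact hT0 (hzero T ((subset_insert_iff_of_notMem hvT).1 hs))
        refine ⟨hnot, ?_⟩
        by_contra hRT
        exact hsep T (hconn T hT0) hnot (fun h => hRT (h.symm.mono_left hR)) (hdis T hT)
      have hRF : R ∉ F := fun h => (hTR R h).1 hR
      refine ⟨_, insert R F, hcover, ?_, ?_, htotal.trans (Nat.mul_le_mul_left d ?_)⟩
      · rw [coe_insert]
        exact hF.insert fun T hT _ => (hTR T hT).2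
      · intro T hT
        rcases mem_insert.1 hT with rfl | hT
        · exact h0
        · exact (Nat.zero_le _ |>.trans_lt (hFw' T hT)).ne'
      · rw [sum_insert hRF, add_comm]
        exact Nat.add_le_add_left (sum_le_sum fun S _ => Nat.sub_le _ _) _

namespace GraphicalGame

theorem sum_value_le_packingNumber (Γ : GraphicalGame G) {F : Finset (Finset V)}
    (hF : (F : Set (Finset V)).PairwiseDisjoint id) : ∑ T ∈ F, Γ.value T ≤ Γ.packingNumber := by
  refine Γ.isGreatest_packingNumber.2 ⟨fun S => if S ∈ F then 1 else 0, fun i => ?_, ?_⟩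
  · rw [sum_boole, Nat.cast_id, card_le_one]
    intro S hS T hT
    simp only [mem_filter, mem_univ, true_and] at hS hT
    by_contra hne
    exact disjoint_left.1 (hF hS.2 hT.2 hne) hS.1 hT.1
  · simp [packingValue]

theorem value_le_packingNumber (Γ : GraphicalGame G) (S : Finset V) :
    Γ.value S ≤ Γ.packingNumber := by
  simpa using Γ.sum_value_le_packingNumber (F := {S}) (by simp)

theorem packingCoveringRatio_le_of_isCover (Γ : GraphicalGame G) {d : ℕ} {x : V → ℕ}
    (hx : Γ.IsCover x) (hle : ∑ i, x i ≤ d * Γ.packingNumber) :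
    Γ.packingCoveringRatio ≤ d := by
  refine ENNReal.div_le_of_le_mul ?_
  exact_mod_cast (Γ.isLeast_coveringNumber.2 ⟨x, hx, rfl⟩).trans hle

theorem packingCoveringRatio_le_vcDim_insert_empty (Γ : GraphicalGame G) {d : ℕ}
    (hd : (insert ∅ (graphicalSetFamily G)).vcDim ≤ d) : Γ.packingCoveringRatio ≤ d := by
  obtain ⟨x, F, hx, hF, -, hsum⟩ :=
    (hasConnectedFront_empty G).exists_cover_pairwiseDisjoint hd Γ.value
      (fun S => not_imp_comm.1 (Γ.value_eq_zero S))
      (fun S hS => by rw [subset_empty.1 hS, Γ.value_empty])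
  exact Γ.packingCoveringRatio_le_of_isCover hx
    (hsum.trans (Nat.mul_le_mul_left d (Γ.sum_value_le_packingNumber hF)))

theorem packingCoveringRatio_le_of_card_le (Γ : GraphicalGame G) {d : ℕ} (hd : 1 ≤ d)
    (hcard : Fintype.card V ≤ d + 1) : Γ.packingCoveringRatio ≤ d := by
  rcases isEmpty_or_nonempty V with hV | ⟨⟨a⟩⟩
  · exact Γ.packingCoveringRatio_le_of_isCover (x := 0)
      (fun S => by simp [S.eq_empty_of_isEmpty, Γ.value_empty]) (by simp)
  have ha := Γ.value_le_packingNumber {a}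
  refine Γ.packingCoveringRatio_le_of_isCover
    -- A set containing `a` and another vertex receives at least the packing number; a set avoiding
    -- `a` packs together with `{a}`.
    (x := fun i => if i = a then Γ.value {a} else Γ.packingNumber - Γ.value {a})
    (fun S => ?_) ?_
  · by_cases haS : a ∈ S
    · rw [← add_sum_erase S _ haS, if_pos rfl]
      rcases (S.erase a).eq_empty_or_nonempty with h | ⟨b, hb⟩
      · rw [h, sum_empty, add_zero,
          ((erase_eq_empty_iff S a).1 h).resolve_left (ne_empty_of_mem haS)]
      · have h1 := single_le_sum (f := fun i => if i = a then Γ.value {a} else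
          Γ.packingNumber - Γ.value {a}) (fun _ _ => Nat.zero_le _) hb
        simp only [if_neg (ne_of_mem_erase hb)] at h1
        have h2 := Γ.value_le_packingNumber S
        omega
    · rcases S.eq_empty_or_nonempty with rfl | ⟨b, hb⟩
      · simp [Γ.value_empty]
      · have hne : b ≠ a := fun e => haS (e ▸ hb)
        have h1 := single_le_sum (f := fun i => if i = a then Γ.value {a} else
          Γ.packingNumber - Γ.value {a}) (fun _ _ => Nat.zero_le _) hb
        simp only [if_neg hne] at h1
        have hSa : S ≠ {a} := fun e => haS (e ▸ mem_singleton_self a)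
        have h2 := Γ.sum_value_le_packingNumber (F := {S, {a}}) (by
          rw [coe_pair]
          exact (Set.pairwiseDisjoint_singleton _ _).insert fun T hT _ =>
            hT ▸ disjoint_singleton_right.2 haS)
        rw [sum_pair hSa] at h2
        exact (Nat.le_sub_of_add_le h2).trans h1
  · rw [← add_sum_erase univ _ (mem_univ a), if_pos rfl,
      sum_congr rfl fun i hi => if_neg (ne_of_mem_erase hi), sum_const,
      card_erase_of_mem (mem_univ a), card_univ, smul_eq_mul]
    obtain ⟨k, hk⟩ := Nat.exists_eq_add_of_le ha
    rw [hk, Nat.add_sub_cancel_left, mul_add]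
    exact add_le_add (Nat.le_mul_of_pos_left _ hd) (Nat.mul_le_mul_right k (by omega))

end GraphicalGame

end Covering

/-! ### Dropping the empty set -/

section EmptySet

open Finset

variable {V : Type*} [Fintype V] [DecidableEq V] {G : SimpleGraph V}

/-- Proper subsets of `V` do not need the empty set in order to be shattered. -/
theorem shatters_of_shatters_insert_empty {X : Finset V} (hX : X ≠ univ)
    (h : (insert ∅ (graphicalSetFamily G)).Shatters X) : (graphicalSetFamily G).Shatters X := by
  intro Y hY
  rcases Y.eq_empty_or_nonempty with rfl | hne
  · obtain ⟨v, hv⟩ : ∃ v, v ∉ X := by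
      by_contra! hall
      exact hX (eq_univ_iff_forall.2 hall)
    -- A singleton outside `X` replaces `∅` as witness of the empty trace.
    exact ⟨{v}, mem_graphicalSetFamily.2 (connected_induce_singleton G v),
      inter_singleton_of_notMem hv⟩
  · obtain ⟨S, hS, rfl⟩ := h hY
    refine ⟨S, (mem_insert.1 hS).resolve_left ?_, rfl⟩
    rintro rfl
    simp at hne

/-- Only `univ` can lose shatteredness without `∅`; if it was shattered, deleting one vertex leaves
a proper subset that stays shattered. -/
theorem vcDim_insert_empty_le_or_card_le (hV : Fintype.card V ≠ 1) :
    (insert ∅ (graphicalSetFamily G)).vcDim ≤ (graphicalSetFamily G).vcDim ∨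
      1 ≤ (graphicalSetFamily G).vcDim ∧ Fintype.card V ≤ (graphicalSetFamily G).vcDim + 1 := by
  rcases isEmpty_or_nonempty V with hV' | ⟨⟨a⟩⟩
  · exact .inl (Finset.sup_le fun X _ => by simp [X.eq_empty_of_isEmpty])
  by_cases h : (insert ∅ (graphicalSetFamily G)).Shatters univ
  · have h1 := (shatters_of_shatters_insert_empty (erase_ne_self.2 (mem_univ a))
      (h.mono_right (subset_univ (univ.erase a)))).card_le_vcDim
    rw [card_erase_of_mem (mem_univ a), card_univ] at h1
    have h2 : 0 < Fintype.card V := Fintype.card_pos_iff.2 ⟨a⟩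
    omega
  · refine .inl (Finset.sup_le fun X hX => ?_)
    rw [mem_shatterer] at hX
    exact (shatters_of_shatters_insert_empty (fun e => h (e ▸ hX)) hX).card_le_vcDim

end EmptySet

/-- The packing-covering ratio of every game on `G` is at most the VC-dimension of the graphical set
family of `G`: for every finite graph if the empty set is counted as connected, and for every
finite graph other than the one-vertex graph if it is not. -/
theorem mainTheorem11 {V : Type*} [Fintype V] [DecidableEq V] (G : SimpleGraph V) (d : ℕ) :
    ((insert ∅ (graphicalSetFamily G)).vcDim = d →
      ∀ Γ : GraphicalGame G, Γ.packingCoveringRatio ≤ (d : ENNReal)) ∧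
    (Fintype.card V ≠ 1 → (graphicalSetFamily G).vcDim = d →
      ∀ Γ : GraphicalGame G, Γ.packingCoveringRatio ≤ (d : ENNReal)) := by
  refine ⟨fun h Γ => Γ.packingCoveringRatio_le_vcDim_insert_empty h.le, ?_⟩
  rintro hV rfl Γ
  rcases vcDim_insert_empty_le_or_card_le (G := G) hV with h | ⟨h1, h2⟩
  · exact Γ.packingCoveringRatio_le_vcDim_insert_empty h
  · exact Γ.packingCoveringRatio_le_of_card_le h1 h2
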